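/- Let $\Bbbk$ be a field, $K$ a finite abstract simplicial complex, $p\ge 0$ an integer, and $\mathcal M$ a smooth finite-dimensional manifold without boundary. A filter function on $K$ is a function $f:K\to\mathbb R$ with $f(\sigma)\le f(\sigma')$ whenever $\sigma\subseteq\sigma'$. Write $\mathrm{Dgm}_p(f)$ for the barcode of its persistence module $t\mapsto H_p(K^t;\Bbbk)$, where $K^t=\{\sigma\in K: f(\sigma)\le t\}$: if this module is isomorphic to $\bigoplus_{J\in\mathcal J}\mathbb I_J$ with $\mathcal J$ a finite multiset of intervals, then $\mathrm{Dgm}_p(f)=\{(\inf J,\sup J)\}_{J\in\mathcal J}\cup\Delta^\infty$, a multiset of points of $\mathbb R\times(\mathbb R\cup\{+\infty\})$ in which every point of the diagonal $\Delta=\{(b,b): b\in\mathbb R\}$ is included countably many times. Two filter functions $f,g$ are ordering equivalent, $f\sim g$, if $f(\sigma)\le f(\sigma')\iff g(\sigma)\le g(\sigma')$ for all $\sigma,\sigma'\in K$. A barcode template of $f$ in degree $p$ is a pair $(P_p,U_p)$, where $P_p$ is a finite multiset of pairs of simplices of $K$ and $U_p$ a finite multiset of simplices of $K$, such that $$\mathrm{Dgm}_p(f)=\{(f(\sigma),f(\sigma'))\}_{(\sigma,\sigma')\in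 P_p}\cup\{(f(\tau),+\infty)\}_{\tau\in U_p}\cup\Delta^\infty .$$ For $m,n\ge 0$ let $Q_{m,n}$ send $(b_1,d_1,\dots,b_m,d_m,v_1,\dots,v_n)\in\mathbb R^{2m}\times\mathbb R^n$ to the barcode $\{(b_i,d_i)\}_{i=1}^m\cup\{(v_j,+\infty)\}_{j=1}^n\cup\Delta^\infty$. A local $C^1$ lift around $\theta\in\mathcal M$ of a barcode valued map $B$ on $\mathcal M$ is a map $\tilde B$ to some $\mathbb R^{2m}\times\mathbb R^n$ which on some open neighbourhood of $\theta$ is of class $C^1$ and satisfies $B=Q_{m,n}\circ\tilde B$; the differential of $B$ at $\theta$ with respect to $\tilde B$ is then $d_{\theta,\tilde B}B:=d_\theta\tilde B: T_\theta\mathcal M\to\mathbb R^{2m}\times\mathbb R^n$. **Proposition (differential formula).** Let $F:\mathcal M\to\mathbb R^K$ be a continuous map all of whose values $F(\theta)$ are filter functions, let $F$ be of class $C^1$ on an open set $U\subseteq\mathcal M$, and put $B_p(\theta)=\mathrm{Dgm}_p(F(\theta))$. Let $\tilde{\mathcal M}$ be the set of all $\theta\in\mathcal M$ that have an open neighbourhood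 $U_\theta$ with $F(\theta')\sim F(\theta)$ for all $\theta'\in U_\theta$. Let $\theta\in U\cap\tilde{\mathcal M}$ and let $(P_p,U_p)$ be a barcode template of $F(\theta)$ in degree $p$. Then for any ordering $(\sigma_1,\sigma'_1),\dots,(\sigma_m,\sigma'_m)$ of $P_p$ and any ordering $\tau_1,\dots,\tau_n$ of $U_p$ (with multiplicities), the map $$\tilde B_p:\theta'\mapsto\big[(F(\theta')(\sigma_i),F(\theta')(\sigma'_i))_{i=1}^m,\ (F(\theta')(\tau_j))_{j=1}^n\big]\in\mathbb R^{2m}\times\mathbb R^n$$ is a local $C^1$ lift of $B_p$ around $\theta$, and the corresponding differential of $B_p$ at $\theta$ is $$d_{\theta,\tilde B_p}B_p(\cdot)=\big[(d_\theta F(\cdot)(\sigma_i),d_\theta F(\cdot)(\sigma'_i))_{i=1}^m,\ (d_\theta F(\cdot)(\tau_j))_{j=1}^n\big].$$ -/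

import Mathlib

open CategoryTheory Topology
open scoped Manifold ContDiff

universe u v

noncomputable section

/-! ### Barcodes and ordered barcodes -/

/-- The extended plane `ℝ × (ℝ ∪ {+∞})` in which the points of barcodes live. -/
abbrev ExtPlane : Type := ℝ × WithTop ℝ

open scoped Classical in
/-- The multiset union `B ∪ Δ^∞` of a finite multiset `B` of points with countably many copies of
the diagonal `Δ = {(b, b)}`, given by its multiplicity function. -/
def addDiagonal (B : Multiset ExtPlane) : ExtPlane → ℕ∞ :=
  fun x => (B.count x : ℕ∞) + if x.2 = (x.1 : WithTop ℝ) then ⊤ else 0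

/-- The set `Bar` of barcodes (persistence diagrams): all `B ∪ Δ^∞` with `B` a finite multiset,
where a multiset of points is recorded by its multiplicity function. -/
def Bar : Type := {D : ExtPlane → ℕ∞ // ∃ B : Multiset ExtPlane, D = addDiagonal B}

/-- The barcode `B ∪ Δ^∞`. -/
def Bar.mk (B : Multiset ExtPlane) : Bar := ⟨addDiagonal B, B, rfl⟩

/-- The Euclidean space `ℝ^{2m} × ℝ^n` of ordered barcodes. The coordinates `Sum.inl (i, 0)`,
`Sum.inl (i, 1)` and `Sum.inr j` are `b_i`, `d_i` and `v_j`. -/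
abbrev OrderedBarcode (m n : ℕ) : Type := EuclideanSpace ℝ (Fin m × Fin 2 ⊕ Fin n)

/-- The quotient map `Q_{m,n}`, sending `(b_1, d_1, …, b_m, d_m, v_1, …, v_n)` to
`{(b_i, d_i)} ∪ {(v_j, +∞)} ∪ Δ^∞`. -/
def barQuotient (m n : ℕ) (x : OrderedBarcode m n) : Bar :=
  Bar.mk
    ((Finset.univ : Finset (Fin m)).val.map
        (fun i => (x (Sum.inl (i, 0)), (x (Sum.inl (i, 1)) : WithTop ℝ))) +
      (Finset.univ : Finset (Fin n)).val.map
        (fun j => (x (Sum.inr j), (⊤ : WithTop ℝ))))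

/-! ### Persistence modules and their barcodes -/

/-- Persistence modules over the field `k`: functors from `(ℝ, ≤)` to `k`-vector spaces. -/
abbrev PersistenceModule (k : Type v) [Field k] : Type _ := ℝ ⥤ ModuleCat.{max u v} k

/-- The space of an interval module at `t`: a copy of `k` if `t ∈ J`, and zero otherwise. -/
def intervalSpace (k : Type v) [Field k] (J : Set ℝ) (t : ℝ) : Submodule k (ULift.{u} k) where
  carrier := {x | t ∉ J → x = 0}
  add_mem' := fun hx hy ht => by rw [hx ht, hy ht, add_zero]
  zero_mem' := fun _ => rfl
  smul_mem' := fun c _ hx ht => by rw [hx ht, smul_zero]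

open scoped Classical in
/-- The structure map of an interval module: the identity of `k` if both parameters lie in the
interval, and zero otherwise (an element at a parameter outside `J` is zero anyway). -/
def intervalMap (k : Type v) [Field k] (J : Set ℝ) (s t : ℝ) :
    intervalSpace.{u} k J s →ₗ[k] intervalSpace.{u} k J t where
  toFun x := ⟨if t ∈ J then x.1 else 0, fun ht => if_neg ht⟩
  map_add' x y := by
    apply Subtype.ext
    by_cases h : t ∈ J <;> simp [h]
  map_smul' c x := by
    apply Subtype.ext
    by_cases h : t ∈ J <;> simp [h]

/-- The interval module `𝕀_J` of an interval `J` of `ℝ`. -/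
def intervalModule (k : Type v) [Field k] (J : Set ℝ) (hJ : J.OrdConnected) :
    PersistenceModule.{u} k where
  obj t := ModuleCat.of k (intervalSpace.{u} k J t)
  map {s t} _ := ModuleCat.ofHom (intervalMap.{u} k J s t)
  map_id t := by
    refine ModuleCat.hom_ext (LinearMap.ext fun x => Subtype.ext ?_)
    by_cases h : t ∈ J
    · simp [intervalMap, h]
    · simpa [intervalMap, h] using (x.2 h).symm
  map_comp {r s t} f g := by
    refine ModuleCat.hom_ext (LinearMap.ext fun x => Subtype.ext ?_)
    by_cases ht : t ∈ J
    · by_cases hs : s ∈ J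
      · simp [intervalMap, ht, hs]
      · have hr : r ∉ J := fun hr => hs (hJ.out hr ht ⟨f.le, g.le⟩)
        simpa [intervalMap, ht, hs] using x.2 hr
    · simp [intervalMap, ht]

open scoped Classical in
/-- The point `(inf J, sup J)` of the extended plane, for `J` nonempty and bounded below. -/
def intervalPoint (J : Set ℝ) : ExtPlane :=
  (sInf J, if BddAbove J then ((sSup J : ℝ) : WithTop ℝ) else ⊤)

/-- `D` is a barcode of `𝕍`: the module `𝕍` is isomorphic to a finite direct sum `⨁ i, 𝕀_{J i}` of
interval modules, and `D = {(inf J i, sup J i)} ∪ Δ^∞`. The intervals are nonempty, and bounded below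
because the points of a barcode have a real first coordinate. -/
def HasBarcode (k : Type v) [Field k] (W : PersistenceModule.{u} k) (D : Bar) : Prop :=
  ∃ (N : ℕ) (J : Fin N → Set ℝ) (hJ : ∀ i, (J i).OrdConnected),
    (∀ i, (J i).Nonempty) ∧ (∀ i, BddBelow (J i)) ∧
    Nonempty (W ≅ ∐ fun i => intervalModule.{u} k (J i) (hJ i)) ∧
    D = Bar.mk ((Finset.univ : Finset (Fin N)).val.map fun i => intervalPoint (J i))

open scoped Classical in
/-- The barcode of a persistence module of finite type. By the uniqueness of interval decompositions
it does not depend on the choice. A module without a barcode gets the value `Δ^∞`, which is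
not relevant for the sublevel set persistent homology of a filter function on a finite complex:
such a module always has a barcode. -/
def barcodeOf (k : Type v) [Field k] (W : PersistenceModule.{u} k) : Bar :=
  if h : ∃ D, HasBarcode k W D then h.choose else Bar.mk 0

/-! ### Filter functions on a finite simplicial complex and their persistent homology

A finite abstract simplicial complex is a `PreAbstractSimplicialComplex V` on a finite type `V`
(not every element of `V` has to be a vertex). -/

instance simplicesFintype {V : Type u} [Fintype V] (K : PreAbstractSimplicialComplex V) :
    Fintype K :=
  Fintype.ofFinite K

/-- `f : K → ℝ` is a filter function: it is monotone with respect to inclusions of faces. -/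
def IsFilterFunction {V : Type u} {K : PreAbstractSimplicialComplex V} (f : K → ℝ) : Prop :=
  ∀ σ σ' : K, (σ : Finset V) ⊆ σ' → f σ ≤ f σ'

/-- The sublevel complex `K^t = {σ ∈ K | f σ ≤ t}`. -/
def sublevelComplex {V : Type u} {K : PreAbstractSimplicialComplex V} (f : K → ℝ)
    (hf : IsFilterFunction f) (t : ℝ) : PreAbstractSimplicialComplex V where
  faces := {σ | ∃ h : σ ∈ K, f ⟨σ, h⟩ ≤ t}
  isRelLowerSet_faces := by
    rintro σ ⟨hσ, hσt⟩
    refine ⟨(K.isRelLowerSet_faces hσ).1, fun ρ hρσ hρ => ?_⟩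
    have hρK : ρ ∈ K := (K.isRelLowerSet_faces hσ).2 hρσ hρ
    exact ⟨hρK, (hf ⟨ρ, hρK⟩ ⟨σ, hσ⟩ hρσ).trans hσt⟩

theorem sublevelComplex_mono {V : Type u} {K : PreAbstractSimplicialComplex V} (f : K → ℝ)
    (hf : IsFilterFunction f) : Monotone (sublevelComplex f hf) :=
  fun _ _ hst _ hσ => ⟨hσ.1, hσ.2.trans hst⟩

open scoped Classical in
/-- The geometric realization `|L|` of a complex on a finite vertex type: the points of the standard
simplex (barycentric coordinates on `V`) whose support is a simplex of `L`. -/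
def realization {V : Type u} [Fintype V] (L : PreAbstractSimplicialComplex V) : Set (V → ℝ) :=
  {x | x ∈ stdSimplex ℝ V ∧ (Finset.univ.filter fun w => x w ≠ 0) ∈ L}

theorem realization_mono {V : Type u} [Fintype V] {L L' : PreAbstractSimplicialComplex V}
    (h : L ≤ L') : realization L ⊆ realization L' :=
  fun _ hx => ⟨hx.1, h hx.2⟩

/-- Geometric realization, as a functor from the poset of complexes on `V` to spaces; the maps
are the inclusions. -/
def realizationFunctor (V : Type u) [Fintype V] : PreAbstractSimplicialComplex V ⥤ TopCat.{u} where
  obj L := TopCat.of (realization L)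
  map {_ _} h := TopCat.ofHom
    ⟨Set.inclusion (realization_mono h.le), continuous_inclusion (realization_mono h.le)⟩
  map_id _ := rfl
  map_comp _ _ := rfl

/-- Singular homology in degree `p` with coefficients in the field `k`. -/
def singularHomologyOver (k : Type v) [Field k] (p : ℕ) : TopCat.{u} ⥤ ModuleCat.{max u v} k :=
  (AlgebraicTopology.singularHomologyFunctor.{u} (ModuleCat.{max u v} k) p).obj
    (ModuleCat.of k (ULift.{u} k))

/-- The sublevel set persistent homology `𝐇_p(f)` of a filter function: the spaces `H_p(K^t)`
with the maps induced by the inclusions `K^s ⊆ K^t`. -/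
def persistentHomology (k : Type v) [Field k] (p : ℕ) {V : Type u} [Fintype V]
    {K : PreAbstractSimplicialComplex V} (f : K → ℝ) (hf : IsFilterFunction f) :
    PersistenceModule.{u} k :=
  (sublevelComplex_mono f hf).functor ⋙ realizationFunctor V ⋙ singularHomologyOver k p

/-- The barcode `Dgm_p(f)` of a filter function in degree `p`. -/
def Dgm (k : Type v) [Field k] (p : ℕ) {V : Type u} [Fintype V]
    {K : PreAbstractSimplicialComplex V} (f : K → ℝ) (hf : IsFilterFunction f) : Bar :=
  barcodeOf.{u} k (persistentHomology k p f hf)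

/-- Ordering equivalence `f ∼ g`: both functions induce the same pre-order on `K`. -/
def OrderingEquivalent {V : Type u} {K : PreAbstractSimplicialComplex V} (f g : K → ℝ) : Prop :=
  ∀ σ σ' : K, f σ ≤ f σ' ↔ g σ ≤ g σ'

/-- `(P, T)` is a barcode template of `f` in degree `p`:
`Dgm_p(f) = {(f σ, f σ')}_{(σ, σ') ∈ P} ∪ {(f τ, +∞)}_{τ ∈ T} ∪ Δ^∞`. -/
def IsBarcodeTemplate (k : Type v) [Field k] (p : ℕ) {V : Type u} [Fintype V]
    {K : PreAbstractSimplicialComplex V} (f : K → ℝ) (hf : IsFilterFunction f)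
    (P : Multiset (K × K)) (T : Multiset K) : Prop :=
  Dgm k p f hf = Bar.mk (P.map (fun q => (f q.1, (f q.2 : WithTop ℝ))) +
    T.map (fun τ => (f τ, (⊤ : WithTop ℝ))))

/-- The vector `[(f σ_i, f σ'_i)_i, (f τ_j)_j]` of `ℝ^{2m} × ℝ^n`. -/
def readSimplices {V : Type u} {K : PreAbstractSimplicialComplex V} {m n : ℕ}
    (σ σ' : Fin m → K) (τ : Fin n → K) (f : K → ℝ) : OrderedBarcode m n :=
  WithLp.toLp 2 (Sum.elim (fun q => if q.2 = 0 then f (σ q.1) else f (σ' q.1)) fun j => f (τ j))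

/-! ### Barcode valued maps on a manifold -/

section Manifold

variable {E : Type*} [NormedAddCommGroup E] [NormedSpace ℝ E] {H : Type*} [TopologicalSpace H]
  (I : ModelWithCorners ℝ E H) {M : Type*} [TopologicalSpace M] [ChartedSpace H M]

/-- `Btilde` is a local `C^r` lift of `B : M → Bar` around `x`: on some open neighborhood of `x` it is
of class `C^r` and satisfies `B = Q_{m,n} ∘ Btilde`. -/
def IsLocalLift (r : WithTop ℕ∞) (B : M → Bar) (x : M) {m n : ℕ}
    (Btilde : M → OrderedBarcode m n) : Prop :=
  ∃ O : Set M, IsOpen O ∧ x ∈ O ∧ ContMDiffOn I 𝓘(ℝ, OrderedBarcode m n) r Btilde O ∧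
    ∀ x' ∈ O, B x' = barQuotient m n (Btilde x')

/-- The differential `d_{x, Btilde} B : T_x M → ℝ^{2m} × ℝ^n` of `B` at `x` with respect to a `C^1`
local lift `Btilde`: the differential of `Btilde` at `x`. -/
def barcodeDifferential {B : M → Bar} {x : M} {m n : ℕ} {Btilde : M → OrderedBarcode m n}
    (_ : IsLocalLift I 1 B x Btilde) : TangentSpace I x →L[ℝ] OrderedBarcode m n :=
  mfderiv I 𝓘(ℝ, OrderedBarcode m n) Btilde x

/-- The differential `d_θ F : T_θ M → ℝ^K`, with the tangent space of `ℝ^K` identified with `ℝ^K`. -/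
def parametrizationDifferential {V : Type u} [Fintype V] {K : PreAbstractSimplicialComplex V}
    (F : M → EuclideanSpace ℝ K) (θ : M) : TangentSpace I θ →L[ℝ] EuclideanSpace ℝ K :=
  mfderiv I 𝓘(ℝ, EuclideanSpace ℝ K) F θ

end Manifold

/-- The barcode valued map `B_p : θ ↦ Dgm_p(F θ)` of a parametrization `F` by filter functions. -/
def barcodeMap (k : Type v) [Field k] (p : ℕ) {V : Type u} [Fintype V]
    {K : PreAbstractSimplicialComplex V} {M : Type*} (F : M → EuclideanSpace ℝ K)
    (hF : ∀ θ, IsFilterFunction (F θ)) (θ : M) : Bar :=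
  Dgm k p (F θ) (hF θ)

/-- The set of parameters around which `F` is locally constant up to ordering equivalence. -/
def orderStableSet {V : Type u} [Fintype V] {K : PreAbstractSimplicialComplex V} {M : Type*}
    [TopologicalSpace M] (F : M → EuclideanSpace ℝ K) : Set M :=
  {θ | ∃ O : Set M, IsOpen O ∧ θ ∈ O ∧ ∀ θ' ∈ O, OrderingEquivalent (F θ') (F θ)}

end

/-!
On a finite complex, two filter functions with the same pre-order differ by an order automorphism
`ψ` of `ℝ`: their values can be matched by a strictly increasing map of finite sets, which extends
to the line. Hence the sublevel filtrations, and with them the persistence modules, agree up to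
reparametrization by `ψ`, and `ψ` carries one barcode to the other. This uses that the barcode
is an invariant of the module: the ranks of the structure maps `W s ⟶ W t` count the intervals
containing both `s` and `t`, and letting `s` and `t` approach given numbers from either side
isolates the intervals with given endpoints. A barcode template at `θ` is therefore a template at
all nearby parameters, so that the lift is `F` followed by a fixed linear map, and the formula is
the chain rule.
-/

section OrderAutomorphism

variable {α : Type*} [Field α] [LinearOrder α] [IsStrictOrderedRing α]

theorem strictMono_min_add_mul_max (c : α) {l : α} (hl : 0 < l) :
    StrictMono fun x => min x c + l * max (x - c) 0 := by
  intro x y hxy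
  rcases le_total y c with hy | hy
  · simpa [hy, hxy.le.trans hy] using hxy
  · rcases le_total x c with hx | hx
    · rcases hx.lt_or_eq with hx' | rfl
      · simpa [hx, hy] using hx'.trans_le (le_add_of_nonneg_right
          (mul_nonneg hl.le (sub_nonneg.2 hy)))
      · simpa [hy] using mul_pos hl (sub_pos.2 hxy)
    · simpa [hx, hy, hl] using hxy

theorem min_add_mul_max_inv_mul (c : α) {l : α} (hl : 0 < l) (x : α) :
    min (min x c + l⁻¹ * max (x - c) 0) c +
      l * max (min x c + l⁻¹ * max (x - c) 0 - c) 0 = x := by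
  rcases le_total x c with hx | hx
  · simp [hx]
  · have : 0 ≤ l⁻¹ * (x - c) := mul_nonneg (inv_nonneg.2 hl.le) (sub_nonneg.2 hx)
    simp [hx, this, hl.ne']

theorem exists_orderIso_fix_le {c y z : α} (hy : c < y) (hz : c < z) :
    ∃ χ : α ≃o α, (∀ x ≤ c, χ x = x) ∧ χ y = z := by
  have hl : 0 < (z - c) / (y - c) := div_pos (sub_pos.2 hz) (sub_pos.2 hy)
  refine ⟨(strictMono_min_add_mul_max c hl).orderIsoOfRightInverse _ _
    (min_add_mul_max_inv_mul c hl), fun x hx => ?_, ?_⟩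
  · simp [hx]
  · simp [hy.le, (sub_pos.2 hy).ne']

theorem exists_orderIso_extend (S : Finset α) (h : α → α) (hS : StrictMonoOn h S) :
    ∃ ψ : α ≃o α, ∀ x ∈ S, ψ x = h x := by
  induction S using Finset.induction_on_max with
  | empty => exact ⟨OrderIso.refl α, by simp⟩
  | insert a S hlt ih =>
    obtain ⟨ψ, hψ⟩ := ih (hS.mono (by simp))
    have hlt_left : ∀ y ∈ S.image ψ, ∀ z ∈ ({ψ a, h a} : Finset α), y < z := by
      simp only [Finset.forall_mem_image, Finset.forall_mem_insert, Finset.mem_singleton,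
        forall_eq]
      exact fun x hx => ⟨ψ.strictMono (hlt x hx), hψ x hx ▸
        hS (Finset.mem_insert_of_mem hx) (Finset.mem_insert_self a S) (hlt x hx)⟩
    obtain ⟨c, hSc, hc⟩ := Finset.exists_between' _ _ hlt_left
    obtain ⟨χ, hχ, hχa⟩ := exists_orderIso_fix_le (hc (ψ a) (by simp)) (hc (h a) (by simp))
    refine ⟨ψ.trans χ, (Finset.forall_mem_insert ..).2 ⟨by simpa using hχa, fun x hx => ?_⟩⟩
    rw [OrderIso.trans_apply, hχ _ (hSc _ (Finset.mem_image_of_mem ψ hx)).le, hψ x hx]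

theorem exists_orderIso_comp_eq {ι : Type*} [Finite ι] {f g : ι → α}
    (hfg : ∀ i j, f i ≤ f j ↔ g i ≤ g j) : ∃ ψ : α ≃o α, ∀ i, ψ (f i) = g i := by
  cases nonempty_fintype ι
  have hext : ∀ i, Function.extend f g 0 (f i) = g i :=
    Function.FactorsThrough.extend_apply (fun i j hij =>
      le_antisymm ((hfg i j).1 hij.le) ((hfg j i).1 hij.ge)) 0
  obtain ⟨ψ, hψ⟩ := exists_orderIso_extend (Finset.univ.image f) (Function.extend f g 0) (by
    simp only [StrictMonoOn, Finset.coe_image, Finset.coe_univ, Set.image_univ,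
      Set.forall_mem_range, hext]
    exact fun i j hij => lt_of_not_ge fun hji => hij.not_ge ((hfg j i).2 hji))
  exact ⟨ψ, fun i => (hψ _ (Finset.mem_image_of_mem f (Finset.mem_univ i))).trans (hext i)⟩

end OrderAutomorphism

universe w

section StructureMapRank

open Limits

variable {k : Type v} [Field k]

theorem finrank_range_eq_of_comp_eq_comp {V V' W W' : Type*} [AddCommGroup V] [Module k V]
    [AddCommGroup V'] [Module k V'] [AddCommGroup W] [Module k W] [AddCommGroup W'] [Module k W']
    {f : V →ₗ[k] W} {g : V' →ₗ[k] W'} (e : V ≃ₗ[k] V') (e' : W ≃ₗ[k] W')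
    (h : e'.toLinearMap ∘ₗ f = g ∘ₗ e.toLinearMap) :
    Module.finrank k (LinearMap.range f) = Module.finrank k (LinearMap.range g) := by
  rw [← LinearMap.range_comp_of_range_eq_top g e.range, ← h, LinearMap.range_comp]
  exact (LinearEquiv.finrank_map_eq e' _).symm

theorem finrank_range_piMap {ι : Type*} [Fintype ι] {V W : ι → Type*}
    [∀ i, AddCommGroup (V i)] [∀ i, Module k (V i)] [∀ i, AddCommGroup (W i)]
    [∀ i, Module k (W i)] [∀ i, Module.Finite k (W i)] (f : ∀ i, V i →ₗ[k] W i) :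
    Module.finrank k (LinearMap.range (LinearMap.piMap f)) =
      ∑ i, Module.finrank k (LinearMap.range (f i)) := by
  have hsurj : LinearMap.range (LinearMap.piMap fun i => (f i).rangeRestrict) = ⊤ :=
    LinearMap.range_eq_top.2 (Function.Surjective.piMap fun i => (f i).surjective_rangeRestrict)
  have hinj : Function.Injective (LinearMap.piMap fun i => (LinearMap.range (f i)).subtype) :=
    Function.Injective.piMap fun i => Subtype.val_injective
  calc
    Module.finrank k (LinearMap.range (LinearMap.piMap f))
    _ = Module.finrank k
          (LinearMap.range (LinearMap.piMap fun i => (LinearMap.range (f i)).subtype)) := by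
        rw [← LinearMap.range_comp_of_range_eq_top _ hsurj]
        rfl
    _ = ∑ i, Module.finrank k (LinearMap.range (f i)) := by
        rw [LinearMap.finrank_range_of_inj hinj, Module.finrank_pi_fintype]

variable {C : Type*} [Category* C]

/-- The rank of a structure map of a diagram of vector spaces, with the value `0` of `finrank` when
the range is infinite-dimensional. -/
noncomputable def structureMapRank (W : C ⥤ ModuleCat.{w} k) {s t : C} (f : s ⟶ t) : ℕ :=
  Module.finrank k (LinearMap.range (W.map f).hom)

theorem structureMapRank_congr {W W' : C ⥤ ModuleCat.{w} k} (e : W ≅ W') {s t : C} (f : s ⟶ t) :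
    structureMapRank W f = structureMapRank W' f :=
  finrank_range_eq_of_comp_eq_comp (e.app s).toLinearEquiv (e.app t).toLinearEquiv
    (ModuleCat.hom_ext_iff.1 (e.hom.naturality f))

-- Without this, instance search finds no biproducts in a functor category.
attribute [local instance] HasFiniteBiproducts.of_hasFiniteProducts

/-- Finite biproducts of diagrams of vector spaces are computed pointwise, as products. -/
noncomputable def biproductObjEquiv {ι : Type} [Finite ι] (W : ι → C ⥤ ModuleCat.{w} k) (t : C) :
    (⨁ W).obj t ≃ₗ[k] ∀ i, (W i).obj t :=
  (((evaluation C (ModuleCat.{w} k)).obj t).mapBiproduct W ≪≫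
    ModuleCat.biproductIsoPi (fun i => (W i).obj t)).toLinearEquiv

theorem biproductObjEquiv_apply {ι : Type} [Finite ι] (W : ι → C ⥤ ModuleCat.{w} k) (t : C)
    (x : (⨁ W).obj t) (i : ι) :
    biproductObjEquiv W t x i = ((biproduct.π W i).app t).hom x := by
  have h : (((evaluation C (ModuleCat.{w} k)).obj t).mapBiproduct W ≪≫
        ModuleCat.biproductIsoPi (fun i => (W i).obj t)).hom ≫
          ModuleCat.ofHom (LinearMap.proj i : (∀ j, (W j).obj t) →ₗ[k] (W i).obj t) =
      (biproduct.π W i).app t := by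
    rw [← ModuleCat.biproductIsoPi_inv_comp_π, Iso.trans_hom, Category.assoc,
      Iso.hom_inv_id_assoc, Functor.mapBiproduct_hom]
    exact biproduct.lift_π _ _
  exact LinearMap.congr_fun (ModuleCat.hom_ext_iff.1 h) x

theorem structureMapRank_sigma {ι : Type} [Fintype ι] (W : ι → C ⥤ ModuleCat.{w} k)
    {s t : C} [∀ i, Module.Finite k ((W i).obj t)] (f : s ⟶ t) :
    structureMapRank (∐ W) f = ∑ i, structureMapRank (W i) f := by
  rw [structureMapRank_congr (biproduct.isoCoproduct W).symm f]
  refine (finrank_range_eq_of_comp_eq_comp (biproductObjEquiv W s) (biproductObjEquiv W t) ?_).trans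
    (finrank_range_piMap fun i => ((W i).map f).hom)
  ext x i
  simp only [LinearMap.coe_comp, LinearEquiv.coe_coe, Function.comp_apply, biproductObjEquiv_apply,
    NatTrans.naturality_apply, LinearMap.coe_piMap, Pi.map_apply]

end StructureMapRank

section IntervalModule

theorem finrank_intervalSpace_of_mem (k : Type v) [Field k] {J : Set ℝ} {t : ℝ} (ht : t ∈ J) :
    Module.finrank k (intervalSpace.{u} k J t) = 1 := by
  have : intervalSpace.{u} k J t = ⊤ := eq_top_iff.2 fun _ _ h => absurd ht h
  rw [this, finrank_top, LinearEquiv.finrank_eq ULift.moduleEquiv, Module.finrank_self]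

instance finite_intervalModule_obj (k : Type v) [Field k] (J : Set ℝ) (hJ : J.OrdConnected)
    (t : ℝ) :
    Module.Finite k ((intervalModule.{u} k J hJ).obj t) :=
  inferInstanceAs (Module.Finite k (intervalSpace.{u} k J t))

theorem range_intervalMap_of_mem (k : Type v) [Field k] {J : Set ℝ} {s t : ℝ} (hs : s ∈ J) :
    LinearMap.range (intervalMap.{u} k J s t) = ⊤ := by
  refine LinearMap.range_eq_top.2 fun y => ⟨⟨y.1, fun h => absurd hs h⟩, Subtype.ext ?_⟩
  by_cases ht : t ∈ J
  · simp [intervalMap, ht]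
  · simp [intervalMap, ht, y.2 ht]

theorem intervalMap_eq_zero (k : Type v) [Field k] {J : Set ℝ} {s t : ℝ} (h : ¬(s ∈ J ∧ t ∈ J)) :
    intervalMap.{u} k J s t = 0 := by
  ext x : 2
  by_cases ht : t ∈ J
  · simp [intervalMap, x.2 fun hs => h ⟨hs, ht⟩]
  · simp [intervalMap, ht]

open scoped Classical in
theorem structureMapRank_intervalModule (k : Type v) [Field k] {J : Set ℝ} (hJ : J.OrdConnected)
    {s t : ℝ} (f : s ⟶ t) :
    structureMapRank (intervalModule.{u} k J hJ) f = if s ∈ J ∧ t ∈ J then 1 else 0 := by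
  change Module.finrank k (LinearMap.range (intervalMap.{u} k J s t)) = _
  split_ifs with h
  · rw [range_intervalMap_of_mem k h.1, finrank_top, finrank_intervalSpace_of_mem k h.2]
  · rw [intervalMap_eq_zero k h, LinearMap.range_zero, finrank_bot]

end IntervalModule

section Counting

variable {ι ι' : Type*} [Finite ι] [Finite ι']

theorem ncard_and_eq_of_eventually {β : Type*} {l : Filter β} [l.NeBot] {R : ι → Prop}
    {R' : ι' → Prop} {P : β → ι → Prop} {P' : β → ι' → Prop} {Q : ι → Prop} {Q' : ι' → Prop}
    (h : ∀ᶠ s in l, {i | R i ∧ P s i}.ncard = {i | R' i ∧ P' s i}.ncard)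
    (hQ : ∀ i, ∀ᶠ s in l, P s i ↔ Q i) (hQ' : ∀ i, ∀ᶠ s in l, P' s i ↔ Q' i) :
    {i | R i ∧ Q i}.ncard = {i | R' i ∧ Q' i}.ncard := by
  obtain ⟨s, hs, hsQ, hsQ'⟩ :=
    (h.and ((Filter.eventually_all.2 hQ).and (Filter.eventually_all.2 hQ'))).exists
  simpa only [hsQ, hsQ'] using hs

theorem ncard_and_le {α : Type*} [PartialOrder α] (R : ι → Prop) (x : ι → α) (a : α) :
    {i | R i ∧ x i ≤ a}.ncard = {i | R i ∧ x i < a}.ncard + {i | R i ∧ x i = a}.ncard := by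
  rw [← Set.ncard_union_eq (Set.disjoint_left.2 fun i hlt heq => hlt.2.ne heq.2)]
  simp only [le_iff_lt_or_eq, and_or_left, Set.ofPred_or]

theorem ncard_and_eq_of_le_of_lt {α : Type*} [PartialOrder α] {R : ι → Prop} {R' : ι' → Prop}
    {x : ι → α} {x' : ι' → α} {a : α}
    (hle : {i | R i ∧ x i ≤ a}.ncard = {i | R' i ∧ x' i ≤ a}.ncard)
    (hlt : {i | R i ∧ x i < a}.ncard = {i | R' i ∧ x' i < a}.ncard) :
    {i | R i ∧ x i = a}.ncard = {i | R' i ∧ x' i = a}.ncard := by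
  rw [ncard_and_le, ncard_and_le, hlt] at hle
  exact Nat.add_left_cancel hle

end Counting

section Endpoints

theorem mem_and_mem_iff_of_ordConnected {α : Type*} [Preorder α] {J : Set α}
    (hJ : J.OrdConnected) {s t : α} (hst : s ≤ t) :
    s ∈ J ∧ t ∈ J ↔ t ∈ lowerClosure J ∧ s ∈ upperClosure J := by
  constructor
  · exact fun ⟨hs, ht⟩ => ⟨subset_lowerClosure ht, subset_upperClosure hs⟩
  · rintro ⟨⟨y, hy, hty⟩, ⟨x, hx, hxs⟩⟩
    exact ⟨hJ.out hx hy ⟨hxs, hst.trans hty⟩, hJ.out hx hy ⟨hxs.trans hst, hty⟩⟩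

variable {J : Set ℝ}

theorem mem_upperClosure_of_sInf_lt (hne : J.Nonempty) {s : ℝ} (h : sInf J < s) :
    s ∈ upperClosure J :=
  have ⟨x, hx, hxs⟩ := exists_lt_of_csInf_lt hne h
  ⟨x, hx, hxs.le⟩

theorem sInf_le_of_mem_upperClosure (hb : BddBelow J) {s : ℝ} (h : s ∈ upperClosure J) :
    sInf J ≤ s :=
  have ⟨_, hx, hxs⟩ := h
  (csInf_le hb hx).trans hxs

theorem mem_lowerClosure_of_lt_intervalPoint (hne : J.Nonempty) {t : ℝ}
    (h : (t : WithTop ℝ) < (intervalPoint J).2) : t ∈ lowerClosure J := by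
  obtain ⟨x, hx, htx⟩ : ∃ x ∈ J, t < x := by
    by_cases hB : BddAbove J
    · exact exists_lt_of_lt_csSup hne (by simpa [intervalPoint, hB] using h)
    · exact not_bddAbove_iff.1 hB t
  exact ⟨x, hx, htx.le⟩

theorem le_intervalPoint_of_mem_lowerClosure {t : ℝ} (h : t ∈ lowerClosure J) :
    (t : WithTop ℝ) ≤ (intervalPoint J).2 := by
  obtain ⟨x, hx, htx⟩ := h
  by_cases hB : BddAbove J
  · simpa [intervalPoint, hB] using htx.trans (le_csSup hB hx)
  · simp [intervalPoint, hB]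

theorem eventually_mem_upperClosure_nhdsGT (hne : J.Nonempty) (hb : BddBelow J) (b : ℝ) :
    ∀ᶠ s in 𝓝[>] b, s ∈ upperClosure J ↔ sInf J ≤ b := by
  rcases le_or_gt (sInf J) b with h | h
  · filter_upwards [self_mem_nhdsWithin] with s hs
    exact iff_of_true (mem_upperClosure_of_sInf_lt hne (h.trans_lt hs)) h
  · filter_upwards [mem_nhdsWithin_of_mem_nhds (Iio_mem_nhds h)] with s hs
    exact iff_of_false (fun hmem => hs.not_ge (sInf_le_of_mem_upperClosure hb hmem)) h.not_ge

theorem eventually_mem_upperClosure_nhdsLT (hne : J.Nonempty) (hb : BddBelow J) (b : ℝ) :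
    ∀ᶠ s in 𝓝[<] b, s ∈ upperClosure J ↔ sInf J < b := by
  rcases lt_or_ge (sInf J) b with h | h
  · filter_upwards [mem_nhdsWithin_of_mem_nhds (Ioi_mem_nhds h)] with s hs
    exact iff_of_true (mem_upperClosure_of_sInf_lt hne hs) h
  · filter_upwards [self_mem_nhdsWithin] with s (hs : s < b)
    exact iff_of_false (fun hmem => (hs.trans_le h).not_ge (sInf_le_of_mem_upperClosure hb hmem))
      h.not_gt

theorem eventually_mem_lowerClosure_nhdsGT (hne : J.Nonempty) (d : ℝ) :
    ∀ᶠ t in 𝓝[>] d, t ∈ lowerClosure J ↔ (d : WithTop ℝ) < (intervalPoint J).2 := by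
  rcases lt_or_ge (d : WithTop ℝ) (intervalPoint J).2 with h | h
  · have hcont : ∀ᶠ t : ℝ in 𝓝 d, (t : WithTop ℝ) < (intervalPoint J).2 :=
      WithTop.continuous_coe.continuousAt.eventually_lt_const h
    filter_upwards [mem_nhdsWithin_of_mem_nhds hcont] with t ht
    exact iff_of_true (mem_lowerClosure_of_lt_intervalPoint hne ht) h
  · filter_upwards [self_mem_nhdsWithin] with t ht
    exact iff_of_false (fun hmem => (h.trans_lt (WithTop.coe_lt_coe.2 ht)).not_ge
      (le_intervalPoint_of_mem_lowerClosure hmem)) h.not_gt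

theorem eventually_mem_lowerClosure_nhdsLT (hne : J.Nonempty) (d : ℝ) :
    ∀ᶠ t in 𝓝[<] d, t ∈ lowerClosure J ↔ (d : WithTop ℝ) ≤ (intervalPoint J).2 := by
  rcases le_or_gt (d : WithTop ℝ) (intervalPoint J).2 with h | h
  · filter_upwards [self_mem_nhdsWithin] with t ht
    exact iff_of_true (mem_lowerClosure_of_lt_intervalPoint hne
      ((WithTop.coe_lt_coe.2 ht).trans_le h)) h
  · have hcont : ∀ᶠ t : ℝ in 𝓝 d, (intervalPoint J).2 < (t : WithTop ℝ) :=
      WithTop.continuous_coe.continuousAt.eventually_const_lt h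
    filter_upwards [mem_nhdsWithin_of_mem_nhds hcont] with t ht
    exact iff_of_false (fun hmem => ht.not_ge (le_intervalPoint_of_mem_lowerClosure hmem)) h.not_ge

theorem eventually_mem_lowerClosure_atTop (hne : J.Nonempty) :
    ∀ᶠ t in Filter.atTop, t ∈ lowerClosure J ↔ (intervalPoint J).2 = ⊤ := by
  by_cases h : (intervalPoint J).2 = ⊤
  · exact .of_forall fun t =>
      iff_of_true (mem_lowerClosure_of_lt_intervalPoint hne (h ▸ WithTop.coe_lt_top t)) h
  · obtain ⟨d, hd⟩ := WithTop.ne_top_iff_exists.1 h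
    filter_upwards [Filter.eventually_gt_atTop d] with t ht
    exact iff_of_false (fun hmem => ht.not_ge (WithTop.coe_le_coe.1
      (hd ▸ le_intervalPoint_of_mem_lowerClosure hmem))) h

theorem fst_le_snd_intervalPoint (hne : J.Nonempty) (hb : BddBelow J) :
    ((intervalPoint J).1 : WithTop ℝ) ≤ (intervalPoint J).2 := by
  by_cases hB : BddAbove J
  · simpa [intervalPoint, hB] using csInf_le_csSup hne hb hB
  · simp [intervalPoint, hB]

end Endpoints

section RankInvariant

/-- The intervals allowed in the decomposition of a persistence module with a barcode. -/
structure IsBarcodeInterval (J : Set ℝ) : Prop where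
  ordConnected : J.OrdConnected
  nonempty : J.Nonempty
  bddBelow : BddBelow J

variable {ι ι' : Type*} [Finite ι] [Finite ι'] {J : ι → Set ℝ} {J' : ι' → Set ℝ}
  (hJ : ∀ i, IsBarcodeInterval (J i)) (hJ' : ∀ i, IsBarcodeInterval (J' i))
  (hrank : ∀ s t, s ≤ t → {i | s ∈ J i ∧ t ∈ J i}.ncard = {i | s ∈ J' i ∧ t ∈ J' i}.ncard)

include hJ hJ' hrank

theorem ncard_mem_lowerClosure_and_sInf_eq {b t : ℝ} (hbt : b < t) :
    {i | t ∈ lowerClosure (J i) ∧ sInf (J i) = b}.ncard =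
      {i | t ∈ lowerClosure (J' i) ∧ sInf (J' i) = b}.ncard := by
  have hclosure : ∀ s ≤ t, {i | t ∈ lowerClosure (J i) ∧ s ∈ upperClosure (J i)}.ncard =
      {i | t ∈ lowerClosure (J' i) ∧ s ∈ upperClosure (J' i)}.ncard := by
    intro s hst
    simpa only [mem_and_mem_iff_of_ordConnected (hJ _).ordConnected hst,
      mem_and_mem_iff_of_ordConnected (hJ' _).ordConnected hst] using hrank s t hst
  have hnear : ∀ᶠ s in 𝓝 b, {i | t ∈ lowerClosure (J i) ∧ s ∈ upperClosure (J i)}.ncard =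
      {i | t ∈ lowerClosure (J' i) ∧ s ∈ upperClosure (J' i)}.ncard :=
    (show ∀ᶠ s in 𝓝 b, s ≤ t from Iic_mem_nhds hbt).mono hclosure
  exact ncard_and_eq_of_le_of_lt
    (ncard_and_eq_of_eventually (hnear.filter_mono (nhdsWithin_le_nhds (s := Set.Ioi b)))
      (fun i => eventually_mem_upperClosure_nhdsGT (hJ i).nonempty (hJ i).bddBelow b)
      fun i => eventually_mem_upperClosure_nhdsGT (hJ' i).nonempty (hJ' i).bddBelow b)
    (ncard_and_eq_of_eventually (hnear.filter_mono (nhdsWithin_le_nhds (s := Set.Iio b)))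
      (fun i => eventually_mem_upperClosure_nhdsLT (hJ i).nonempty (hJ i).bddBelow b)
      fun i => eventually_mem_upperClosure_nhdsLT (hJ' i).nonempty (hJ' i).bddBelow b)

theorem ncard_sInf_eq_and_snd_eq_coe {b d : ℝ} (hbd : b < d) :
    {i | sInf (J i) = b ∧ (intervalPoint (J i)).2 = d}.ncard =
      {i | sInf (J' i) = b ∧ (intervalPoint (J' i)).2 = d}.ncard := by
  have hnear : ∀ᶠ t in 𝓝 d, {i | sInf (J i) = b ∧ t ∈ lowerClosure (J i)}.ncard =
      {i | sInf (J' i) = b ∧ t ∈ lowerClosure (J' i)}.ncard := by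
    filter_upwards [Ioi_mem_nhds hbd] with t ht
    simpa only [and_comm] using ncard_mem_lowerClosure_and_sInf_eq hJ hJ' hrank ht
  exact ncard_and_eq_of_le_of_lt (α := (WithTop ℝ)ᵒᵈ)
    (ncard_and_eq_of_eventually (hnear.filter_mono (nhdsWithin_le_nhds (s := Set.Iio d)))
      (fun i => eventually_mem_lowerClosure_nhdsLT (hJ i).nonempty d)
      fun i => eventually_mem_lowerClosure_nhdsLT (hJ' i).nonempty d)
    (ncard_and_eq_of_eventually (hnear.filter_mono (nhdsWithin_le_nhds (s := Set.Ioi d)))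
      (fun i => eventually_mem_lowerClosure_nhdsGT (hJ i).nonempty d)
      fun i => eventually_mem_lowerClosure_nhdsGT (hJ' i).nonempty d)

theorem ncard_sInf_eq_and_snd_eq_top (b : ℝ) :
    {i | sInf (J i) = b ∧ (intervalPoint (J i)).2 = ⊤}.ncard =
      {i | sInf (J' i) = b ∧ (intervalPoint (J' i)).2 = ⊤}.ncard := by
  have hlarge : ∀ᶠ t in Filter.atTop, {i | sInf (J i) = b ∧ t ∈ lowerClosure (J i)}.ncard =
      {i | sInf (J' i) = b ∧ t ∈ lowerClosure (J' i)}.ncard := by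
    filter_upwards [Filter.eventually_gt_atTop b] with t ht
    simpa only [and_comm] using ncard_mem_lowerClosure_and_sInf_eq hJ hJ' hrank ht
  exact ncard_and_eq_of_eventually hlarge
    (fun i => eventually_mem_lowerClosure_atTop (hJ i).nonempty)
    fun i => eventually_mem_lowerClosure_atTop (hJ' i).nonempty

theorem ncard_intervalPoint_eq {x : ExtPlane} (hx : x.2 ≠ (x.1 : WithTop ℝ)) :
    {i | intervalPoint (J i) = x}.ncard = {i | intervalPoint (J' i) = x}.ncard := by
  obtain ⟨b, d⟩ := x
  simp only [Prod.ext_iff]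
  rcases hx.lt_or_gt with hdb | hbd
  · have hempty : ∀ {J : Set ℝ}, IsBarcodeInterval J →
        ¬((intervalPoint J).1 = b ∧ (intervalPoint J).2 = d) := by
      rintro J hJ ⟨rfl, rfl⟩
      exact hdb.not_ge (fst_le_snd_intervalPoint hJ.nonempty hJ.bddBelow)
    simp only [hempty (hJ _), hempty (hJ' _), Set.ofPred_false, Set.ncard_empty]
  · induction d using WithTop.recTopCoe with
    | top => exact ncard_sInf_eq_and_snd_eq_top hJ hJ' hrank b
    | coe d => exact ncard_sInf_eq_and_snd_eq_coe hJ hJ' hrank (WithTop.coe_lt_coe.1 hbd)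

end RankInvariant

section Uniqueness

open Limits

theorem structureMapRank_sigma_intervalModule (k : Type v) [Field k] {ι : Type} [Finite ι]
    (J : ι → Set ℝ) (hJ : ∀ i, (J i).OrdConnected) {s t : ℝ} (f : s ⟶ t) :
    structureMapRank (∐ fun i => intervalModule.{u} k (J i) (hJ i)) f =
      {i | s ∈ J i ∧ t ∈ J i}.ncard := by
  classical
  cases nonempty_fintype ι
  simp only [structureMapRank_sigma, structureMapRank_intervalModule, Finset.sum_boole,
    Nat.cast_id, Set.ncard_eq_toFinset_card', Set.toFinset_ofPred]

theorem count_univ_map_eq_ncard {ι β : Type*} [Fintype ι] [DecidableEq β] (f : ι → β) (x : β) :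
    (Finset.univ.val.map f).count x = {i | f i = x}.ncard := by
  simp only [Multiset.count_map, Set.ncard_eq_toFinset_card', Set.toFinset_ofPred, eq_comm (a := x)]
  rfl

open scoped Classical in
theorem addDiagonal_congr {B B' : Multiset ExtPlane}
    (h : ∀ x : ExtPlane, x.2 ≠ (x.1 : WithTop ℝ) → B.count x = B'.count x) :
    addDiagonal B = addDiagonal B' := by
  funext x
  by_cases hx : x.2 = (x.1 : WithTop ℝ)
  · simp [addDiagonal, hx]
  · simp [addDiagonal, hx, h x hx]

variable {k : Type v} [Field k] {W : PersistenceModule.{u} k} {D D' : Bar}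

theorem HasBarcode.unique (h : HasBarcode.{u} k W D) (h' : HasBarcode.{u} k W D') : D = D' := by
  obtain ⟨N, J, hJ, hne, hb, ⟨e⟩, rfl⟩ := h
  obtain ⟨N', J', hJ', hne', hb', ⟨e'⟩, rfl⟩ := h'
  have hrank : ∀ s t, s ≤ t → {i | s ∈ J i ∧ t ∈ J i}.ncard = {i | s ∈ J' i ∧ t ∈ J' i}.ncard := by
    intro s t hst
    rw [← structureMapRank_sigma_intervalModule k J hJ (homOfLE hst),
      ← structureMapRank_sigma_intervalModule k J' hJ' (homOfLE hst),
      structureMapRank_congr (e.symm ≪≫ e')]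
  refine Subtype.ext (addDiagonal_congr fun x hx => ?_)
  rw [count_univ_map_eq_ncard, count_univ_map_eq_ncard]
  exact ncard_intervalPoint_eq (fun i => ⟨hJ i, hne i, hb i⟩) (fun i => ⟨hJ' i, hne' i, hb' i⟩)
    hrank hx

theorem HasBarcode.barcodeOf_eq (h : HasBarcode.{u} k W D) : barcodeOf.{u} k W = D := by
  have hex : ∃ D, HasBarcode.{u} k W D := ⟨D, h⟩
  rw [barcodeOf, dif_pos hex]
  exact hex.choose_spec.unique h

end Uniqueness

section Reparametrization

open Limits

/-- The action of an order automorphism of `ℝ` on the extended plane, fixing `+∞`. -/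
def extPlaneEquiv (ψ : ℝ ≃o ℝ) : ExtPlane ≃ ExtPlane :=
  ψ.toEquiv.prodCongr ψ.withTopCongr.toEquiv

theorem extPlaneEquiv_mem_diagonal_iff (ψ : ℝ ≃o ℝ) (x : ExtPlane) :
    (extPlaneEquiv ψ x).2 = ((extPlaneEquiv ψ x).1 : WithTop ℝ) ↔ x.2 = (x.1 : WithTop ℝ) :=
  ψ.withTopCongr.injective.eq_iff (b := (x.1 : WithTop ℝ))

theorem addDiagonal_map_extPlaneEquiv (ψ : ℝ ≃o ℝ) (B : Multiset ExtPlane) :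
    addDiagonal (B.map (extPlaneEquiv ψ)) = addDiagonal B ∘ (extPlaneEquiv ψ).symm := by
  classical
  refine ((extPlaneEquiv ψ).eq_comp_symm _ _).2 (funext fun x => ?_)
  simp only [addDiagonal, Function.comp_apply, extPlaneEquiv_mem_diagonal_iff,
    Multiset.count_map_eq_count' _ _ (extPlaneEquiv ψ).injective]

/-- The barcode whose points are those of `D`, moved by an order automorphism `ψ` of `ℝ`. -/
def Bar.map (ψ : ℝ ≃o ℝ) (D : Bar) : Bar :=
  ⟨D.1 ∘ (extPlaneEquiv ψ).symm, D.2.elim fun B hB =>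
    ⟨B.map (extPlaneEquiv ψ), hB ▸ (addDiagonal_map_extPlaneEquiv ψ B).symm⟩⟩

theorem Bar.map_mk (ψ : ℝ ≃o ℝ) (B : Multiset ExtPlane) :
    (Bar.mk B).map ψ = Bar.mk (B.map (extPlaneEquiv ψ)) :=
  Subtype.ext (addDiagonal_map_extPlaneEquiv ψ B).symm

theorem intervalPoint_preimage_symm (ψ : ℝ ≃o ℝ) {J : Set ℝ} (hne : J.Nonempty)
    (hb : BddBelow J) : intervalPoint (ψ.symm ⁻¹' J) = extPlaneEquiv ψ (intervalPoint J) := by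
  have himage : ψ.symm ⁻¹' J = ψ '' J := (ψ.toEquiv.image_eq_preimage_symm J).symm
  rw [himage]
  refine Prod.ext (ψ.map_csInf' hne hb).symm ?_
  by_cases h : BddAbove J
  · simp [intervalPoint, extPlaneEquiv, ψ.bddAbove_image, h, ψ.map_csSup' hne h]
  · simp [intervalPoint, extPlaneEquiv, ψ.bddAbove_image, h]

/-- Precomposition with a functor commutes with coproducts, which are computed pointwise. -/
noncomputable def compSigmaIso {C D : Type*} [Category* C] [Category* D] {k : Type v} [Field k]
    {ι : Type} (G : C ⥤ D) (W : ι → D ⥤ ModuleCat.{w} k) : G ⋙ ∐ W ≅ ∐ fun i => G ⋙ W i :=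
  PreservesCoproduct.iso ((Functor.whiskeringLeft C D (ModuleCat.{w} k)).obj G) W

/-- Reparametrizing an interval module by `ψ` moves its interval by `ψ`. -/
noncomputable def intervalModuleReparametrize (k : Type v) [Field k] (ψ : ℝ ≃o ℝ) (J : Set ℝ)
    (hJ : J.OrdConnected) :
    ψ.symm.monotone.functor ⋙ intervalModule.{u} k J hJ ≅
      intervalModule.{u} k (ψ.symm ⁻¹' J) (hJ.preimage_mono ψ.symm.monotone) :=
  NatIso.ofComponents fun _ => Iso.refl _

variable {k : Type v} [Field k] {W W' : PersistenceModule.{u} k} {D : Bar}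

theorem HasBarcode.of_iso (e : W' ≅ W) (h : HasBarcode.{u} k W D) : HasBarcode.{u} k W' D := by
  obtain ⟨N, J, hJ, hne, hb, ⟨i⟩, hD⟩ := h
  exact ⟨N, J, hJ, hne, hb, ⟨e ≪≫ i⟩, hD⟩

theorem HasBarcode.reparametrize (ψ : ℝ ≃o ℝ) (h : HasBarcode.{u} k W D) :
    HasBarcode.{u} k (ψ.symm.monotone.functor ⋙ W) (D.map ψ) := by
  obtain ⟨N, J, hJ, hne, hb, ⟨e⟩, rfl⟩ := h
  refine ⟨N, fun i => ψ.symm ⁻¹' J i, fun i => (hJ i).preimage_mono ψ.symm.monotone,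
    fun i => (hne i).preimage ψ.symm.surjective, fun i => ψ.symm.bddBelow_preimage.2 (hb i),
    ⟨?_⟩, ?_⟩
  · exact Functor.isoWhiskerLeft _ e ≪≫ compSigmaIso _ _ ≪≫
      Sigma.mapIso fun i => intervalModuleReparametrize k ψ (J i) (hJ i)
  · rw [Bar.map_mk, Multiset.map_map]
    congr 1
    exact Multiset.map_congr rfl fun i _ => (intervalPoint_preimage_symm ψ (hne i) (hb i)).symm

theorem barcodeOf_eq_map_of_iso (ψ : ℝ ≃o ℝ) (e : W' ≅ ψ.symm.monotone.functor ⋙ W) :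
    barcodeOf.{u} k W' = (barcodeOf.{u} k W).map ψ := by
  by_cases hW : ∃ D, HasBarcode.{u} k W D
  · obtain ⟨D, hD⟩ := hW
    rw [hD.barcodeOf_eq, ((hD.reparametrize ψ).of_iso e).barcodeOf_eq]
  · have hW' : ¬∃ D, HasBarcode.{u} k W' D := by
      rintro ⟨D, hD⟩
      have e' : W ≅ ψ.monotone.functor ⋙ ψ.symm.monotone.functor ⋙ W :=
        W.leftUnitor.symm ≪≫ Functor.isoWhiskerRight ψ.equivalence.unitIso W
      exact hW ⟨_, ((hD.of_iso e.symm).reparametrize ψ.symm).of_iso e'⟩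
    rw [barcodeOf, barcodeOf, dif_neg hW, dif_neg hW', Bar.map_mk, Multiset.map_zero]

end Reparametrization

section Complex

variable {V : Type u} {K : PreAbstractSimplicialComplex V} {f g : K → ℝ}

theorem sublevelComplex_eq_of_orderIso (hf : IsFilterFunction f) (hg : IsFilterFunction g)
    (ψ : ℝ ≃o ℝ) (hψ : ∀ σ, ψ (f σ) = g σ) (t : ℝ) :
    sublevelComplex g hg t = sublevelComplex f hf (ψ.symm t) := by
  refine SetLike.ext fun σ => exists_congr fun h => ?_
  rw [← hψ, ← ψ.le_symm_apply]

variable [Fintype V]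

/-- Composing a filter function with an order automorphism of `ℝ` reparametrizes its persistent
homology. -/
noncomputable def persistentHomologyReparametrize (k : Type v) [Field k] (p : ℕ)
    (hf : IsFilterFunction f) (hg : IsFilterFunction g) (ψ : ℝ ≃o ℝ) (hψ : ∀ σ, ψ (f σ) = g σ) :
    persistentHomology k p g hg ≅ ψ.symm.monotone.functor ⋙ persistentHomology k p f hf :=
  Functor.isoWhiskerRight
    (NatIso.ofComponents
      (fun t => eqToIso (sublevelComplex_eq_of_orderIso hf hg ψ hψ t))
      (fun _ => Subsingleton.elim _ _) :
      (sublevelComplex_mono g hg).functor ≅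
        ψ.symm.monotone.functor ⋙ (sublevelComplex_mono f hf).functor)
    (realizationFunctor V ⋙ singularHomologyOver k p)

theorem IsBarcodeTemplate.of_orderingEquivalent {k : Type v} [Field k] {p : ℕ}
    {hf : IsFilterFunction f} (hg : IsFilterFunction g) (hfg : OrderingEquivalent f g)
    {P : Multiset (K × K)} {T : Multiset K} (h : IsBarcodeTemplate k p f hf P T) :
    IsBarcodeTemplate k p g hg P T := by
  obtain ⟨ψ, hψ⟩ := exists_orderIso_comp_eq hfg
  have hDgm : Dgm k p g hg = (Dgm k p f hf).map ψ :=
    barcodeOf_eq_map_of_iso ψ (persistentHomologyReparametrize k p hf hg ψ hψ)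
  rw [IsBarcodeTemplate, hDgm, h, Bar.map_mk, Multiset.map_add, Multiset.map_map, Multiset.map_map]
  simp [extPlaneEquiv, hψ]

end Complex

section Lift

variable {V : Type u} {K : PreAbstractSimplicialComplex V} {m n : ℕ} (σ σ' : Fin m → K)
  (τ : Fin n → K)

theorem barQuotient_readSimplices (f : K → ℝ) :
    barQuotient m n (readSimplices σ σ' τ f) =
      Bar.mk ((Finset.univ.val.map fun i => (σ i, σ' i)).map
          (fun q => (f q.1, (f q.2 : WithTop ℝ))) +
        (Finset.univ.val.map τ).map fun τ => (f τ, (⊤ : WithTop ℝ))) := by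
  rw [Multiset.map_map, Multiset.map_map]
  simp [barQuotient, readSimplices]

variable [Fintype V]

/-- `readSimplices` as a continuous linear map. -/
noncomputable def readSimplicesCLM : EuclideanSpace ℝ K →L[ℝ] OrderedBarcode m n :=
  LinearMap.toContinuousLinearMap
    { toFun := fun f => readSimplices σ σ' τ f
      map_add' := fun f g => by
        ext (⟨i, j⟩ | j)
        · by_cases hj : j = 0 <;> simp [readSimplices, hj]
        · simp [readSimplices]
      map_smul' := fun c f => by
        ext (⟨i, j⟩ | j) <;> simp [readSimplices] }

variable {E : Type*} [NormedAddCommGroup E] [NormedSpace ℝ E] {H : Type*} [TopologicalSpace H]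
  {I : ModelWithCorners ℝ E H} {M : Type*} [TopologicalSpace M] [ChartedSpace H M]
  {F : M → EuclideanSpace ℝ K} {θ : M}

theorem mfderiv_readSimplices_apply (hF : MDifferentiableAt I 𝓘(ℝ, EuclideanSpace ℝ K) F θ)
    (w : TangentSpace I θ) :
    mfderiv I 𝓘(ℝ, OrderedBarcode m n) (fun θ' => readSimplices σ σ' τ (F θ')) θ w =
      readSimplices σ σ' τ (parametrizationDifferential I F θ w) :=
  congrArg (fun L => L w)
    (((readSimplicesCLM σ σ' τ).hasMFDerivAt.comp θ hF.hasMFDerivAt).mfderiv)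

theorem isLocalLift_readSimplices {r : WithTop ℕ∞} {k : Type v} [Field k] {p : ℕ}
    (hF : ∀ θ, IsFilterFunction (F θ)) {U : Set M} (hU : IsOpen U)
    (hFU : ContMDiffOn I 𝓘(ℝ, EuclideanSpace ℝ K) r F U) (hθ : θ ∈ U ∩ orderStableSet F)
    (hθT : IsBarcodeTemplate k p (F θ) (hF θ) (Finset.univ.val.map fun i => (σ i, σ' i))
      (Finset.univ.val.map τ)) :
    IsLocalLift I r (barcodeMap k p F hF) θ fun θ' => readSimplices σ σ' τ (F θ') := by
  obtain ⟨hθU, O, hO, hθO, hequiv⟩ := hθ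
  refine ⟨U ∩ O, hU.inter hO, ⟨hθU, hθO⟩, ?_, fun x hx => ?_⟩
  · exact (readSimplicesCLM σ σ' τ).contMDiff.comp_contMDiffOn (hFU.mono Set.inter_subset_left)
  · rw [barQuotient_readSimplices]
    exact hθT.of_orderingEquivalent (hF x) fun a b => (hequiv x hx.2 a b).symm

end Lift

theorem mainTheorem4_general
    (k : Type v) [Field k] (p : ℕ)
    {V : Type u} [Fintype V] (K : PreAbstractSimplicialComplex V)
    {E : Type*} [NormedAddCommGroup E] [NormedSpace ℝ E]
    {H : Type*} [TopologicalSpace H] (I : ModelWithCorners ℝ E H)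
    {M : Type*} [TopologicalSpace M] [ChartedSpace H M]
    (F : M → EuclideanSpace ℝ K) (hF : ∀ θ, IsFilterFunction (F θ))
    (U : Set M) (hU : IsOpen U) (hFU : ContMDiffOn I 𝓘(ℝ, EuclideanSpace ℝ K) 1 F U)
    (θ : M) (hθ : θ ∈ U ∩ orderStableSet F)
    (P : Multiset (K × K)) (T : Multiset K) (hPT : IsBarcodeTemplate k p (F θ) (hF θ) P T)
    (m n : ℕ) (σ σ' : Fin m → K) (τ : Fin n → K)
    (hP : (Finset.univ : Finset (Fin m)).val.map (fun i => (σ i, σ' i)) = P)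
    (hT : (Finset.univ : Finset (Fin n)).val.map τ = T) :
    ∃ h : IsLocalLift I 1 (barcodeMap k p F hF) θ (fun θ' => readSimplices σ σ' τ (F θ')),
      ∀ w : TangentSpace I θ,
        barcodeDifferential I h w =
          readSimplices σ σ' τ (parametrizationDifferential I F θ w) := by
  subst hP hT
  exact ⟨isLocalLift_readSimplices σ σ' τ hF hU hFU hθ hPT,
    mfderiv_readSimplices_apply σ σ' τ
      ((hFU.contMDiffAt (hU.mem_nhds hθ.1)).mdifferentiableAt one_ne_zero)⟩

theorem mainTheorem4
    (k : Type v) [Field k] (p : ℕ)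
    {V : Type u} [Fintype V] (K : PreAbstractSimplicialComplex V)
    {E : Type*} [NormedAddCommGroup E] [NormedSpace ℝ E] [FiniteDimensional ℝ E]
    {H : Type*} [TopologicalSpace H] (I : ModelWithCorners ℝ E H)
    {M : Type*} [TopologicalSpace M] [ChartedSpace H M] [IsManifold I ∞ M]
    [BoundarylessManifold I M]
    (F : M → EuclideanSpace ℝ K) (hF : ∀ θ, IsFilterFunction (F θ)) (hFcont : Continuous F)
    (U : Set M) (hU : IsOpen U) (hFU : ContMDiffOn I 𝓘(ℝ, EuclideanSpace ℝ K) 1 F U)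
    (θ : M) (hθ : θ ∈ U ∩ orderStableSet F)
    (P : Multiset (K × K)) (T : Multiset K) (hPT : IsBarcodeTemplate k p (F θ) (hF θ) P T)
    (m n : ℕ) (σ σ' : Fin m → K) (τ : Fin n → K)
    (hP : (Finset.univ : Finset (Fin m)).val.map (fun i => (σ i, σ' i)) = P)
    (hT : (Finset.univ : Finset (Fin n)).val.map τ = T) :
    ∃ h : IsLocalLift I 1 (barcodeMap k p F hF) θ (fun θ' => readSimplices σ σ' τ (F θ')),
      ∀ w : TangentSpace I θ,
        barcodeDifferential I h w =
          readSimplices σ σ' τ (parametrizationDifferential I F θ w) :=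
  mainTheorem4_general k p K I F hF U hU hFU θ hθ P T hPT m n σ σ' τ hP hT
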